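/- Let $F$ be a field of characteristic different from $2$ and $3$, and let $C$ and $C'$ be smooth plane quartic curves over $F$ (equivalently, via the canonical embedding, smooth non-hyperelliptic curves of genus $3$ presented as plane quartics), with function fields $F(C)$ and $F(C')$. Let $H^0(C,\Omega_C)$ denote the space of those rational differentials in $\Omega_{F(C)/F}$ that are regular everywhere on $C$, and similarly for $C'$. Then $H^0(C,\Omega_C)$ and $H^0(C',\Omega_{C'})$ have dimension $3$ over $F$. Let $i\colon H^0(C,\Omega_C)\to H^0(C',\Omega_{C'})$ be any $F$-linear isomorphism, and let $(\omega_0,\omega_1,\omega_2)$ be any basis of $H^0(C,\Omega_C)$, regarded as homogeneous coordinates on the canonical plane $\mathbb{P}(H^0(C,\Omega_C)^*)$; let $V_\infty$ be the line $\omega_0=0$. Use $(i(\omega_0),i(\omega_1),i(\omega_2))$ as the corresponding homogeneous coordinates on the canonical plane of $C'$. There are (necessarily unique) rational functions $z_1,z_2\in F(C)$ with $\omega_j=z_j\omega_0$ (the affine coordinates on the complement of $V_\infty$, restricted to $C$), and there is a nonzero quartic form $k\in F[X_0,X_1,X_2]$ vanishing on the image of the canonical map, that is, with $k(1,z_1,z_2)=0$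 in $F(C)$. For every such form $k=k_C$, the map $$P_C\colon l\longmapsto \frac{l(1,z_1,z_2)\,dz_1}{\frac{\partial k_C}{\partial X_2}(1,z_1,z_2)}$$ is an $F$-linear isomorphism from the space of linear forms $l\in F[X_0,X_1,X_2]_1$ onto $H^0(C,\Omega_C)$. Likewise, there are (necessarily unique) $z_1',z_2'\in F(C')$ with $i(\omega_j)=z_j'\,i(\omega_0)$, there is a nonzero quartic form $k'$ with $k'(1,z_1',z_2')=0$ in $F(C')$, and for every such form $k'=k_{C'}$ the map $$P_{C'}\colon l\longmapsto \frac{l(1,z_1',z_2')\,dz_1'}{\frac{\partial k_{C'}}{\partial X_2}(1,z_1',z_2')}$$ is an $F$-linear isomorphism from the space of linear forms $F[X_0,X_1,X_2]_1$ onto $H^0(C',\Omega_{C'})$. -/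

import Mathlib

open scoped KaehlerDifferential

/-- A smooth irreducible plane quartic curve over `F`, given by its equation in homogeneous
coordinates `x₀, x₁, x₂`. Smoothness is geometric: over an algebraic closure of `F`, the form and
its three partial derivatives have no common zero in the projective plane. -/
structure SmoothPlaneQuartic (F : Type*) [Field F] where
  form : MvPolynomial (Fin 3) F
  isHomogeneous : form.IsHomogeneous 4
  irreducible : Irreducible form
  smooth : ∀ p : Fin 3 → AlgebraicClosure F, MvPolynomial.aeval p form = 0 →
    (∀ j, MvPolynomial.aeval p (MvPolynomial.pderiv j form) = 0) → p = 0

namespace SmoothPlaneQuartic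

variable {F : Type*} [Field F] (C : SmoothPlaneQuartic F)

/-- The homogeneous coordinate ring `F[x₀, x₁, x₂] / (form)`. -/
abbrev CoordRing : Type _ := MvPolynomial (Fin 3) F ⧸ Ideal.span {C.form}

instance : IsDomain C.CoordRing := by
  have hp : (Ideal.span {C.form}).IsPrime :=
    (Ideal.span_singleton_prime C.irreducible.ne_zero).2 C.irreducible.prime
  exact Ideal.Quotient.isDomain _

/-- The fraction field of the homogeneous coordinate ring (the function field of the affine cone
over the curve). -/
abbrev ConeField : Type _ := FractionRing C.CoordRing

/-- The homogeneous coordinate `x_j`, as an element of the function field of the cone. -/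
noncomputable def coord (j : Fin 3) : C.ConeField :=
  algebraMap C.CoordRing C.ConeField (Ideal.Quotient.mk _ (MvPolynomial.X j))

/-- The function field of the curve, `F(x_i / x_j : i, j)`, inside the function field of the
cone. -/
noncomputable def functionField : IntermediateField F C.ConeField :=
  IntermediateField.adjoin F (Set.range fun q : Fin 3 × Fin 3 => C.coord q.1 / C.coord q.2)

/-- The function field of the curve as a type. -/
abbrev K : Type _ := ↥C.functionField

/-- The rational function `x_i / x_j` on the curve. -/
noncomputable def ratio (i j : Fin 3) : C.K :=
  ⟨C.coord i / C.coord j, IntermediateField.subset_adjoin F _ ⟨(i, j), rfl⟩⟩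

/-- The ring `F[x_i / x_j : i]` of regular functions on the affine open part `x_j ≠ 0` of the
curve. -/
noncomputable def chart (j : Fin 3) : Subalgebra F C.K :=
  Algebra.adjoin F (Set.range fun i => C.ratio i j)

/-- The space `H⁰(C, Ω_C)` of holomorphic (everywhere regular) differentials: the rational
differentials of the curve whose restriction to each of the three standard affine charts, which
cover the curve, is a regular differential, that is, comes from the Kähler differentials of the
coordinate ring of the chart. -/
noncomputable def holomorphicDifferentials : Submodule F (Ω[C.K⁄F]) :=
  ⨅ j : Fin 3, (LinearMap.range
    (KaehlerDifferential.map F F (C.chart j) C.K)).restrictScalars F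

/-- A basis `b` of `H⁰(C, Ω_C)` is a system of homogeneous coordinates on the canonical plane
`ℙ(H⁰(C, Ω_C)*)`; the line `V_∞` is the zero set of `b 0`. The predicate says that
`z j = b j / b 0` (so `z 0 = 1`, and `z 1`, `z 2` are the affine coordinates on the complement of
`V_∞`, pulled back to the curve by the canonical map) and that the nonzero quartic form `k` is an
equation of the image of the canonical map. -/
structure IsCanonicalModel (b : Module.Basis (Fin 3) F C.holomorphicDifferentials)
    (z : Fin 3 → C.K) (k : MvPolynomial (Fin 3) F) : Prop where
  coordinates : ∀ j, (b j : Ω[C.K⁄F]) = z j • (b 0 : Ω[C.K⁄F])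
  isHomogeneous : k.IsHomogeneous 4
  ne_zero : k ≠ 0
  vanishes : MvPolynomial.aeval z k = 0

/-- The map `l ↦ l dz₁ / (∂k/∂z₂)` from linear forms on the plane to rational differentials on
the curve. With `z 0 = 1`, evaluation at `z` is dehomogenization followed by restriction to the
curve. -/
noncomputable def residueMap (z : Fin 3 → C.K) (k : MvPolynomial (Fin 3) F) :
    MvPolynomial.homogeneousSubmodule (Fin 3) F 1 →ₗ[F] Ω[C.K⁄F] where
  toFun l := (MvPolynomial.aeval z (l : MvPolynomial (Fin 3) F) /
    MvPolynomial.aeval z (MvPolynomial.pderiv 2 k)) • KaehlerDifferential.D F C.K (z 1)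
  map_add' l m := by simp [add_div, add_smul]
  map_smul' a l := by simp [smul_div_assoc]

end SmoothPlaneQuartic

/-!
Let `f` be the form defining the curve and let `v = (1, x, y)` be its generic point. Euler's identity
and the relation `df(v) = 0` say that the gradient of `f` at `v` is orthogonal to `v` and to `dv`, so
that the cross product `v × dv` equals `∇f(v) • η` for a rational differential `η`, the Poincaré
residue `dx / (∂f/∂x₂)(v)`. It is not zero, since `∂₂f ∂₁ - ∂₁f ∂₂` induces a derivation of the
function field that does not kill `x` (`D_genericPoint_one_ne_zero`). If `v` is replaced by `λ v`,
then `η` is replaced by `λ⁻¹ η`; under a linear change of coordinates `M` the cross product is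
transformed by the cofactors of `M` and the gradient by the transposed inverse, so that `η` is only
multiplied by a constant.

By the scaling rule and smoothness (the gradient of `f` is unimodular on every chart), the regular
differentials on the chart `x_j ≠ 0` are the multiples of `(x_j / x₀) η` by regular functions
(`mem_range_map_chart_iff`). Hence `h η` is holomorphic exactly if `h` is a section of `𝒪(1)`
divided by `x₀`, and these sections are linear forms because the homogeneous coordinate ring is
saturated (`exists_sub_X_pow_mul_mem_span`). This gives
`H⁰(C, Ω_C) = {l(v) η : l a linear form}`, of dimension `3` (`mem_holomorphicDifferentials_iff`).

A basis of `H⁰(C, Ω_C)` is therefore an invertible matrix `M` of linear forms, and `z` is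
proportional to `M v`. A quartic form `k` vanishing at `z` becomes a multiple of `f` after the
substitution `M`, and the transformation rules turn `l(z) dz₁ / (∂k/∂X₂)(z)` into a constant multiple
of `l(M v) η` (`residueMap_eq`). For this the denominator must not vanish. It is a derivative of `f`
in a constant direction `n`, up to a constant. If that were zero, then Euler's identities for `f` and
its partial derivatives at the point `n`, in which the factors `4` and `3` occur, would make `n` a
singular point (`dirDeriv_form_ne_zero`); this is where the characteristics `2` and `3` are excluded.
-/

open MvPolynomial

/-! ### Polynomials and derivations -/

namespace MvPolynomial

variable {R σ : Type*}

/-- The chain rule for a polynomial evaluated at elements of an algebra with a derivation. -/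
theorem derivation_aeval [CommRing R] [Fintype σ] {A M : Type*} [CommRing A] [Algebra R A]
    [AddCommGroup M] [Module R M] [Module A M] [IsScalarTower R A M] (D : Derivation R A M)
    (v : σ → A) (p : MvPolynomial σ R) :
    D (aeval v p) = ∑ i, aeval v (pderiv i p) • D (v i) := by
  classical
  induction p using MvPolynomial.induction_on with
  | C a => simp
  | add p q hp hq => simp [hp, hq, add_smul, Finset.sum_add_distrib]
  | mul_X p j hp =>
    simp only [map_mul, aeval_X, Derivation.leibniz, hp, pderiv_X, smul_eq_mul, map_add, add_smul,
      Finset.sum_add_distrib, Finset.smul_sum]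
    congr 1
    · rw [Finset.sum_eq_single j]
      · simp
      · intro b _ hb
        simp [hb.symm]
      · simp
    · refine Finset.sum_congr rfl fun i _ => ?_
      rw [smul_smul]

theorem IsHomogeneous.aeval_mul [CommRing R] {A : Type*} [CommRing A] [Algebra R A]
    {p : MvPolynomial σ R} {n : ℕ} (hp : p.IsHomogeneous n) (c : A) (v : σ → A) :
    MvPolynomial.aeval (fun i => c * v i) p = c ^ n * MvPolynomial.aeval v p := by
  classical
  rw [aeval_def, aeval_def, eval₂_eq, eval₂_eq, Finset.mul_sum]
  refine Finset.sum_congr rfl fun d hd => ?_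
  have h : ∑ i ∈ d.support, d i = n := (hp.degree_eq_sum_deg_support hd).symm
  simp only [mul_pow, Finset.prod_mul_distrib, Finset.prod_pow_eq_pow_sum, h]
  ring

/-- Every polynomial is dehomogenized, with respect to `x_j`, from a form of any large enough
degree. -/
theorem exists_isHomogeneous_aeval_eq [CommRing R] {A : Type*} [CommRing A] [Algebra R A]
    (q : MvPolynomial σ R) {j : σ} {v : σ → A} (hv : v j = 1) {N : ℕ} (hN : q.totalDegree ≤ N) :
    ∃ p : MvPolynomial σ R, p.IsHomogeneous N ∧ aeval v p = aeval v q := by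
  refine ⟨∑ k ∈ Finset.range (q.totalDegree + 1), X j ^ (N - k) * homogeneousComponent k q,
    IsHomogeneous.sum _ _ _ fun k hk => ?_, ?_⟩
  · have h := (isHomogeneous_X_pow (R := R) j (N - k)).mul (homogeneousComponent_isHomogeneous k q)
    have hk' := Finset.mem_range.1 hk
    rwa [show N - k + k = N by omega] at h
  · conv_rhs => rw [← sum_homogeneousComponent q]
    simp [hv]

theorem homogeneousComponent_mul_of_isHomogeneous [CommRing R] {p : MvPolynomial σ R} {n : ℕ}
    (hp : p.IsHomogeneous n) (q : MvPolynomial σ R) (k : ℕ) :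
    homogeneousComponent (n + k) (p * q) = p * homogeneousComponent k q := by
  conv_lhs => rw [← sum_homogeneousComponent q, Finset.mul_sum, map_sum]
  have h (i : ℕ) : homogeneousComponent (n + k) (p * homogeneousComponent i q) =
      if i = k then p * homogeneousComponent k q else 0 := by
    rw [homogeneousComponent_of_mem (hp.mul (homogeneousComponent_isHomogeneous i q))]
    by_cases hik : i = k
    · subst hik; simp
    · simp [hik, Ne.symm hik]
  simp only [h, Finset.sum_ite_eq', Finset.mem_range]
  split_ifs with hk
  · rfl
  · rw [homogeneousComponent_eq_zero k q (by omega), mul_zero]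

/-- A power of a variable is a nonzerodivisor modulo the same powers of other variables. -/
theorem mem_span_X_pow_of_mul_mem [CommRing R] {S : Set σ} {i : σ} (hi : i ∉ S) {n : ℕ}
    {c : MvPolynomial σ R}
    (h : X i ^ n * c ∈ Ideal.span ((fun j => (X j : MvPolynomial σ R) ^ n) '' S)) :
    c ∈ Ideal.span ((fun j => (X j : MvPolynomial σ R) ^ n) '' S) := by
  classical
  have hS : (fun j => (X j : MvPolynomial σ R) ^ n) '' S =
      (fun s => monomial s (1 : R)) '' ((fun j => Finsupp.single j n) '' S) := by
    rw [Set.image_image]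
    simp only [X_pow_eq_monomial]
  rw [hS, mem_ideal_span_monomial_image] at h ⊢
  intro m hm
  have hm' : m + Finsupp.single i n ∈ (X i ^ n * c).support := by
    rw [mem_support_iff] at hm ⊢
    rwa [X_pow_eq_monomial, add_comm, coeff_monomial_mul, one_mul]
  obtain ⟨_, ⟨j, hj, rfl⟩, hle⟩ := h _ hm'
  refine ⟨_, ⟨j, hj, rfl⟩, ?_⟩
  have hij : i ≠ j := fun e => hi (e ▸ hj)
  rw [Finsupp.single_le_iff] at hle ⊢
  simpa [Finsupp.single_apply, hij] using hle

/-- The ideal generated by a polynomial `f` in three variables is saturated: if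
`P i / x_i ^ n` does not depend on `i` modulo `f`, then this quotient is a polynomial modulo `f`.
This is the exactness of the Koszul complex of `x₀ ^ n, x₁ ^ n, x₂ ^ n`. -/
theorem exists_sub_X_pow_mul_mem_span [CommRing R] [IsDomain R] {f : MvPolynomial (Fin 3) R}
    (hf : f ≠ 0) {n : ℕ} {P : Fin 3 → MvPolynomial (Fin 3) R}
    (h : ∀ i j, f ∣ X i ^ n * P j - X j ^ n * P i) :
    ∃ e, ∀ i, f ∣ P i - X i ^ n * e := by
  obtain ⟨c₀, hc₀⟩ := h 1 2
  obtain ⟨c₁, hc₁⟩ := h 2 0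
  obtain ⟨c₂, hc₂⟩ := h 0 1
  have hc : X 0 ^ n * c₀ + X 1 ^ n * c₁ + X 2 ^ n * c₂ = 0 := by
    apply mul_left_cancel₀ hf
    linear_combination (-X 0 ^ n) * hc₀ - X 1 ^ n * hc₁ - X 2 ^ n * hc₂
  have h2 : c₂ ∈ Ideal.span ((fun j => (X j : MvPolynomial (Fin 3) R) ^ n) '' {0, 1}) := by
    apply mem_span_X_pow_of_mul_mem (i := 2) (by simp)
    rw [Set.image_pair, Ideal.mem_span_pair]
    exact ⟨-c₀, -c₁, by linear_combination -hc⟩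
  rw [Set.image_pair, Ideal.mem_span_pair] at h2
  obtain ⟨d₁, d₀, hd⟩ := h2
  have h1 : c₁ + X 2 ^ n * d₀ ∈
      Ideal.span ((fun j => (X j : MvPolynomial (Fin 3) R) ^ n) '' {0}) := by
    apply mem_span_X_pow_of_mul_mem (i := 1) (by simp)
    rw [Set.image_singleton, Ideal.mem_span_singleton]
    exact ⟨-c₀ - X 2 ^ n * d₁, by linear_combination hc + X 2 ^ n * hd⟩
  rw [Set.image_singleton, Ideal.mem_span_singleton] at h1
  obtain ⟨d₂, hd₂⟩ := h1
  have hX : ∀ i, (X i : MvPolynomial (Fin 3) R) ^ n ≠ 0 := fun i => pow_ne_zero _ (X_ne_zero i)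
  -- Subtracting the multiples `-d₀, d₁, -d₂` of `f` from `P 0, P 1, P 2` makes the latter
  -- exactly proportional to `x₀ ^ n, x₁ ^ n, x₂ ^ n`.
  have key : X 1 ^ n * (P 0 + f * d₀) = X 0 ^ n * (P 1 - f * d₁) := by
    linear_combination -hc₂ + f * hd
  have h0 : P 0 + f * d₀ ∈
      Ideal.span ((fun j => (X j : MvPolynomial (Fin 3) R) ^ n) '' {0}) := by
    apply mem_span_X_pow_of_mul_mem (i := 1) (by simp)
    rw [Set.image_singleton, Ideal.mem_span_singleton]
    exact ⟨_, key⟩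
  rw [Set.image_singleton, Ideal.mem_span_singleton] at h0
  obtain ⟨e, he⟩ := h0
  have e0 : f ∣ P 0 - X 0 ^ n * e := ⟨-d₀, by linear_combination he⟩
  have e1 : f ∣ P 1 - X 1 ^ n * e :=
    ⟨d₁, mul_left_cancel₀ (hX 0) (by linear_combination X 1 ^ n * he - key)⟩
  have e2 : f ∣ P 2 - X 2 ^ n * e :=
    ⟨-d₂, mul_left_cancel₀ (hX 0) (by linear_combination X 2 ^ n * he - hc₁ - f * hd₂)⟩
  refine ⟨e, fun i => ?_⟩
  fin_cases i
  exacts [e0, e1, e2]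

/-- The linear form with given coefficients. -/
noncomputable def linearForm [CommRing R] [Fintype σ] (c : σ → R) : MvPolynomial σ R :=
  ∑ i, C (c i) * X i

theorem linearForm_isHomogeneous [CommRing R] [Fintype σ] (c : σ → R) :
    (linearForm c).IsHomogeneous 1 :=
  IsHomogeneous.sum _ _ _ fun i _ => isHomogeneous_C_mul_X (c i) i

@[simp]
theorem aeval_linearForm [CommRing R] [Fintype σ] {A : Type*} [CommRing A] [Algebra R A]
    (v : σ → A) (c : σ → R) : aeval v (linearForm c) = ∑ i, c i • v i := by
  simp [linearForm, Algebra.smul_def]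

@[simp]
theorem coeff_linearForm [CommRing R] [Fintype σ] (c : σ → R) (i : σ) :
    coeff (Finsupp.single i 1) (linearForm c) = c i := by
  classical
  simp [linearForm, coeff_sum, coeff_C_mul, coeff_X, Finsupp.single_left_inj]

theorem IsHomogeneous.exists_eq_linearForm [CommRing R] [Fintype σ] {l : MvPolynomial σ R}
    (hl : l.IsHomogeneous 1) : ∃ c, l = linearForm c := by
  rw [← mem_homogeneousSubmodule, homogeneousSubmodule_one_eq_span_X,
    Submodule.mem_span_range_iff_exists_fun] at hl
  obtain ⟨c, rfl⟩ := hl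
  exact ⟨c, by simp [linearForm, smul_eq_C_mul]⟩

/-- The directional derivative of `p` in the constant direction `n`. -/
noncomputable def dirDeriv [CommRing R] [Fintype σ] (n : σ → R) (p : MvPolynomial σ R) :
    MvPolynomial σ R :=
  ∑ i, C (n i) * pderiv i p

theorem pderiv_pderiv_comm [CommRing R] (i j : σ) (p : MvPolynomial σ R) :
    pderiv i (pderiv j p) = pderiv j (pderiv i p) := by
  classical
  have h : ⁅(pderiv i : Derivation R (MvPolynomial σ R) (MvPolynomial σ R)),
      (pderiv j : Derivation R (MvPolynomial σ R) (MvPolynomial σ R))⁆ = 0 := by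
    apply derivation_ext
    intro k
    rw [Derivation.commutator_apply]
    simp [pderiv_X, Pi.single_apply, apply_ite]
  have := congrArg (fun D : Derivation R (MvPolynomial σ R) (MvPolynomial σ R) => D p) h
  simpa [Derivation.commutator_apply, sub_eq_zero] using this

/-- If the derivative of a form in a constant direction `n` vanishes identically, then `n` is
a singular point of its zero set, as Euler's identity at `n` shows. -/
theorem eval_pderiv_eq_zero_of_dirDeriv_eq_zero [CommRing R] [Fintype σ]
    {p : MvPolynomial σ R} {d : ℕ} (hp : p.IsHomogeneous d) {n : σ → R} (h : dirDeriv n p = 0) :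
    (d : R) * eval n p = 0 ∧ ∀ j, ((d - 1 : ℕ) : R) * eval n (pderiv j p) = 0 := by
  have euler {q : MvPolynomial σ R} {m : ℕ} (hq : q.IsHomogeneous m) (hn : dirDeriv n q = 0) :
      (m : R) * eval n q = 0 := by
    have h1 := congrArg (eval n) hq.sum_X_mul_pderiv
    have h2 := congrArg (eval n) hn
    simp only [map_sum, map_mul, eval_X, nsmul_eq_mul, map_natCast, dirDeriv, eval_C,
      map_zero] at h1 h2
    rw [← h1, h2]
  refine ⟨euler hp h, fun j => euler hp.pderiv ?_⟩
  have := congrArg (pderiv j) h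
  simpa [dirDeriv, pderiv_C_mul, pderiv_pderiv_comm j] using this

end MvPolynomial

namespace SmoothPlaneQuartic

/-! ### The curve and its affine charts -/

theorem form_not_dvd {F : Type*} [Field F] (C : SmoothPlaneQuartic F) {n : ℕ} (hn : n < 4)
    {p : MvPolynomial (Fin 3) F} (hp : p.IsHomogeneous n) (h0 : p ≠ 0) : ¬ C.form ∣ p := by
  rintro ⟨q, rfl⟩
  have hq : q ≠ 0 := right_ne_zero_of_mul h0
  have h1 := hp.totalDegree h0
  rw [totalDegree_mul_of_isDomain C.irreducible.ne_zero hq,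
    C.isHomogeneous.totalDegree C.irreducible.ne_zero] at h1
  omega

theorem exists_eq_C_mul_of_form_dvd {F : Type*} [Field F] (C : SmoothPlaneQuartic F)
    {p : MvPolynomial (Fin 3) F} (hp : p.IsHomogeneous 4) (h : C.form ∣ p) :
    ∃ c : F, p = MvPolynomial.C c * C.form := by
  obtain ⟨q, rfl⟩ := h
  by_cases hq : q = 0
  · exact ⟨0, by simp [hq]⟩
  have h1 := hp.totalDegree (mul_ne_zero C.irreducible.ne_zero hq)
  rw [totalDegree_mul_of_isDomain C.irreducible.ne_zero hq,
    C.isHomogeneous.totalDegree C.irreducible.ne_zero] at h1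
  have h2 : q.totalDegree = 0 := by omega
  rw [totalDegree_eq_zero_iff_eq_C] at h2
  exact ⟨_, by rw [← h2, mul_comm]⟩

theorem aeval_coord {F : Type*} [Field F] (C : SmoothPlaneQuartic F)
    (p : MvPolynomial (Fin 3) F) :
    aeval C.coord p = algebraMap C.CoordRing C.ConeField (Ideal.Quotient.mk _ p) := by
  have h : aeval C.coord = (IsScalarTower.toAlgHom F C.CoordRing C.ConeField).comp
      (Ideal.Quotient.mkₐ F (Ideal.span {C.form})) := by
    ext i
    simp [coord]
  exact DFunLike.congr_fun h p

theorem aeval_coord_eq_zero_iff {F : Type*} [Field F] (C : SmoothPlaneQuartic F)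
    (p : MvPolynomial (Fin 3) F) : aeval C.coord p = 0 ↔ C.form ∣ p := by
  rw [aeval_coord, FaithfulSMul.algebraMap_eq_zero_iff, Ideal.Quotient.eq_zero_iff_mem,
    Ideal.mem_span_singleton]

theorem coord_ne_zero {F : Type*} [Field F] (C : SmoothPlaneQuartic F) (j : Fin 3) :
    C.coord j ≠ 0 := fun h =>
  C.form_not_dvd (by norm_num) (isHomogeneous_X F j) (X_ne_zero j)
    ((C.aeval_coord_eq_zero_iff _).1 (by rwa [aeval_X]))

/-- The generic point of the curve in the homogeneous coordinates normalized by `x_j = 1`. -/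
noncomputable def genericPoint {F : Type*} [Field F] (C : SmoothPlaneQuartic F) (j : Fin 3) :
    Fin 3 → C.K :=
  fun i => C.ratio i j

@[simp]
theorem coe_genericPoint {F : Type*} [Field F] (C : SmoothPlaneQuartic F) (i j : Fin 3) :
    (C.genericPoint j i : C.ConeField) = C.coord i / C.coord j := rfl

@[simp]
theorem genericPoint_self {F : Type*} [Field F] (C : SmoothPlaneQuartic F) (j : Fin 3) :
    C.genericPoint j j = 1 :=
  Subtype.ext (by simp [C.coord_ne_zero j])

theorem genericPoint_ne_zero {F : Type*} [Field F] (C : SmoothPlaneQuartic F) (i j : Fin 3) :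
    C.genericPoint j i ≠ 0 := fun h =>
  div_ne_zero (C.coord_ne_zero i) (C.coord_ne_zero j) (congrArg Subtype.val h)

theorem genericPoint_eq_mul {F : Type*} [Field F] (C : SmoothPlaneQuartic F) (j : Fin 3) :
    C.genericPoint j = fun i => (C.genericPoint 0 j)⁻¹ * C.genericPoint 0 i := by
  funext i
  apply Subtype.ext
  have h0 := C.coord_ne_zero 0
  have hj := C.coord_ne_zero j
  simp only [IntermediateField.coe_mul, IntermediateField.coe_inv, coe_genericPoint]
  field_simp

theorem aeval_genericPoint_eq_zero_iff {F : Type*} [Field F] (C : SmoothPlaneQuartic F)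
    {p : MvPolynomial (Fin 3) F} {n : ℕ} (hp : p.IsHomogeneous n) (j : Fin 3) :
    aeval (C.genericPoint j) p = 0 ↔ C.form ∣ p := by
  have h1 : aeval C.coord p = C.coord j ^ n * (aeval (C.genericPoint j) p : C.K) := by
    have h2 : C.coord = fun i => C.coord j * (C.genericPoint j i : C.ConeField) := by
      funext i
      simp [mul_div_cancel₀ _ (C.coord_ne_zero j)]
    conv_lhs => rw [h2, hp.aeval_mul]
    congr 1
    exact (MvPolynomial.comp_aeval_apply (C.genericPoint j) C.functionField.val p).symm
  rw [← C.aeval_coord_eq_zero_iff, h1, mul_eq_zero_iff_left (pow_ne_zero _ (C.coord_ne_zero j))]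
  exact (ZeroMemClass.coe_eq_zero).symm

theorem aeval_genericPoint_form {F : Type*} [Field F] (C : SmoothPlaneQuartic F) (j : Fin 3) :
    aeval (C.genericPoint j) C.form = 0 :=
  (C.aeval_genericPoint_eq_zero_iff C.isHomogeneous j).2 dvd_rfl

theorem aeval_genericPoint_ne_zero {F : Type*} [Field F] (C : SmoothPlaneQuartic F)
    {p : MvPolynomial (Fin 3) F} {n : ℕ} (hp : p.IsHomogeneous n) (hn : n < 4) (h0 : p ≠ 0)
    (j : Fin 3) : aeval (C.genericPoint j) p ≠ 0 := by
  rw [Ne, C.aeval_genericPoint_eq_zero_iff hp]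
  exact C.form_not_dvd hn hp h0

theorem chart_eq_range {F : Type*} [Field F] (C : SmoothPlaneQuartic F) (j : Fin 3) :
    C.chart j = (aeval (C.genericPoint j) : MvPolynomial (Fin 3) F →ₐ[F] C.K).range :=
  Algebra.adjoin_range_eq_range_aeval F (C.genericPoint j)

theorem aeval_genericPoint_mem_chart {F : Type*} [Field F] (C : SmoothPlaneQuartic F) (j : Fin 3)
    (p : MvPolynomial (Fin 3) F) : aeval (C.genericPoint j) p ∈ C.chart j :=
  C.chart_eq_range j ▸ ⟨p, rfl⟩

/-- A rational function which, for every `j`, is the product of `x_j / x₀` and a regular function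
on the chart `x_j ≠ 0` is the quotient of a linear form by `x₀`: the sections of `𝒪(1)` on the
curve are linear forms. -/
theorem exists_linearForm_of_mem_chart {F : Type*} [Field F] (C : SmoothPlaneQuartic F) {h : C.K}
    (hh : ∀ j, ∃ a ∈ C.chart j, h = a * C.genericPoint 0 j) :
    ∃ c : Fin 3 → F, h = aeval (C.genericPoint 0) (linearForm c) := by
  choose a ha hha using hh
  simp only [chart_eq_range] at ha
  choose q hq using ha
  obtain ⟨M, hqM⟩ : ∃ M, ∀ j, (q j).totalDegree ≤ M :=
    ⟨∑ j, (q j).totalDegree, fun j => Finset.single_le_sum (f := fun j => (q j).totalDegree)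
      (fun _ _ => Nat.zero_le _) (Finset.mem_univ j)⟩
  -- The summand `3` makes the forms `x_j p_j` below of degree at least `4`.
  obtain ⟨N, hN⟩ : ∃ N, N = M + 3 := ⟨_, rfl⟩
  have hqN (j : Fin 3) : (q j).totalDegree ≤ N := (hqM j).trans (by omega)
  choose p hp hpq using fun j =>
    exists_isHomogeneous_aeval_eq (q j) (C.genericPoint_self j) (hqN j)
  have hP (j : Fin 3) : (X j * p j).IsHomogeneous (N + 1) := by
    rw [add_comm]
    exact (isHomogeneous_X F j).mul (hp j)
  have hval (j : Fin 3) :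
      aeval (C.genericPoint 0) (X j * p j) = C.genericPoint 0 j ^ N * h := by
    have h1 : aeval (C.genericPoint j) (p j) = a j := (hpq j).trans (hq j)
    rw [C.genericPoint_eq_mul j, (hp j).aeval_mul] at h1
    have h2 := C.genericPoint_ne_zero j 0
    rw [map_mul, aeval_X, hha j, ← h1, inv_pow]
    field_simp
  have hdvd (i j : Fin 3) :
      C.form ∣ X i ^ N * (X j * p j) - X j ^ N * (X i * p i) := by
    rw [← C.aeval_genericPoint_eq_zero_iff
      (((isHomogeneous_X_pow i N).mul (hP j)).sub ((isHomogeneous_X_pow j N).mul (hP i))) 0,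
      map_sub, map_mul _ (X i ^ N), map_mul _ (X j ^ N), hval, hval]
    simp only [map_pow, aeval_X]
    ring
  obtain ⟨e, he⟩ := exists_sub_X_pow_mul_mem_span C.irreducible.ne_zero hdvd
  have hcomp : C.form ∣ X 0 * p 0 - X 0 ^ N * homogeneousComponent 1 e := by
    obtain ⟨r, hr⟩ := he 0
    have h1 := congrArg (homogeneousComponent (N + 1)) hr
    rw [map_sub, homogeneousComponent_eq_self (hP 0),
      homogeneousComponent_mul_of_isHomogeneous (isHomogeneous_X_pow 0 N),
      show N + 1 = 4 + M by omega,
      homogeneousComponent_mul_of_isHomogeneous C.isHomogeneous] at h1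
    exact ⟨_, h1⟩
  obtain ⟨c, hc⟩ := (homogeneousComponent_isHomogeneous 1 e).exists_eq_linearForm
  refine ⟨c, ?_⟩
  rw [← C.aeval_genericPoint_eq_zero_iff ((hP 0).sub ((isHomogeneous_X_pow 0 N).mul
    (homogeneousComponent_isHomogeneous 1 e))) 0, hc, map_sub, hval, map_mul, map_pow, aeval_X,
    genericPoint_self] at hcomp
  linear_combination hcomp

end SmoothPlaneQuartic

namespace SmoothPlaneQuartic

/-! ### Consequences of smoothness -/

/-- On each affine chart the partial derivatives of the form generate the unit ideal: the Jacobian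
criterion combined with the Nullstellensatz. -/
theorem exists_sum_mul_pderiv_eq_one {F : Type*} [Field F] (C : SmoothPlaneQuartic F)
    (j : Fin 3) : ∃ a : Fin 3 → C.chart j,
      ∑ i, (a i : C.K) * aeval (C.genericPoint j) (pderiv i C.form) = 1 := by
  set I : Ideal (MvPolynomial (Fin 3) F) :=
    Ideal.span ({C.form, X j - 1} ∪ Set.range fun i => pderiv i C.form) with hI
  have hz : zeroLocus (AlgebraicClosure F) I = ∅ := by
    rw [hI, zeroLocus_span, Set.eq_empty_iff_forall_notMem]
    intro x hx
    have h1 : x j - 1 = 0 := by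
      have h := hx (X j - 1) (by simp)
      rwa [map_sub, aeval_X, map_one] at h
    have h2 : x = 0 := C.smooth x (hx _ (by simp)) fun i => hx _ (by simp)
    simp [h2] at h1
  have htop : (1 : MvPolynomial (Fin 3) F) ∈ I := by
    rw [← Ideal.eq_top_iff_one, ← Ideal.radical_eq_top,
      ← vanishingIdeal_zeroLocus_eq_radical (K := AlgebraicClosure F), hz, vanishingIdeal_empty]
  rw [hI, Ideal.span_union, Submodule.mem_sup] at htop
  obtain ⟨u, hu, w, hw, huw⟩ := htop
  rw [Ideal.mem_span_pair] at hu
  rw [Ideal.mem_span_range_iff_exists_fun] at hw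
  obtain ⟨r, s, rfl⟩ := hu
  obtain ⟨a, rfl⟩ := hw
  refine ⟨fun i => ⟨_, C.aeval_genericPoint_mem_chart j (a i)⟩, ?_⟩
  have h3 := congrArg (aeval (C.genericPoint j)) huw
  simpa [C.aeval_genericPoint_form j] using h3

/-- Away from characteristics `2` and `3`, no derivative of the form in a constant direction
vanishes. -/
theorem dirDeriv_form_ne_zero {F : Type*} [Field F] (h2 : (2 : F) ≠ 0) (h3 : (3 : F) ≠ 0)
    (C : SmoothPlaneQuartic F) {n : Fin 3 → F} (hn : n ≠ 0) : dirDeriv n C.form ≠ 0 := by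
  intro h
  obtain ⟨h4, h5⟩ := eval_pderiv_eq_zero_of_dirDeriv_eq_zero C.isHomogeneous h
  have h22 : ((4 : ℕ) : F) ≠ 0 := by
    have := mul_ne_zero h2 h2
    norm_num at this ⊢
    exact this
  have h33 : ((4 - 1 : ℕ) : F) ≠ 0 := by simpa using h3
  have hev (p : MvPolynomial (Fin 3) F) :
      aeval (fun i => algebraMap F (AlgebraicClosure F) (n i)) p =
        algebraMap F (AlgebraicClosure F) (eval n p) := by
    rw [← MvPolynomial.coe_aeval_eq_eval, RingHom.coe_coe]
    exact aeval_algebraMap_apply (AlgebraicClosure F) n p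
  have h6 := C.smooth (fun i => algebraMap F (AlgebraicClosure F) (n i))
    (by rw [hev, (mul_eq_zero_iff_left h22).1 h4, map_zero])
    (fun j => by rw [hev, (mul_eq_zero_iff_left h33).1 (h5 j), map_zero])
  exact hn (funext fun i => by simpa using congrFun h6 i)

theorem aeval_dirDeriv_ne_zero {F : Type*} [Field F] (h2 : (2 : F) ≠ 0) (h3 : (3 : F) ≠ 0)
    (C : SmoothPlaneQuartic F) {n : Fin 3 → F} (hn : n ≠ 0) (j : Fin 3) :
    aeval (C.genericPoint j) (dirDeriv n C.form) ≠ 0 :=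
  C.aeval_genericPoint_ne_zero (n := 3)
    (IsHomogeneous.sum _ _ _ fun _ _ => C.isHomogeneous.pderiv.C_mul _) (by norm_num)
    (C.dirDeriv_form_ne_zero h2 h3 hn) j

theorem pderiv_two_form_ne_zero {F : Type*} [Field F] (h2 : (2 : F) ≠ 0) (h3 : (3 : F) ≠ 0)
    (C : SmoothPlaneQuartic F) : pderiv 2 C.form ≠ 0 := by
  have h := C.dirDeriv_form_ne_zero h2 h3 (n := Pi.single 2 1) (by simp)
  simpa [dirDeriv, Fin.sum_univ_three] using h

theorem aeval_pderiv_two_ne_zero {F : Type*} [Field F] (h2 : (2 : F) ≠ 0) (h3 : (3 : F) ≠ 0)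
    (C : SmoothPlaneQuartic F) (j : Fin 3) :
    aeval (C.genericPoint j) (pderiv 2 C.form) ≠ 0 :=
  C.aeval_genericPoint_ne_zero (n := 3) C.isHomogeneous.pderiv (by norm_num)
    (C.pderiv_two_form_ne_zero h2 h3) j

/-! ### Differentials of the function field -/

/-- The differential of `x₁ / x₀` is nonzero: the derivation `∂₂f ∂₁ - ∂₁f ∂₂` of the polynomial
ring kills the form `f`, hence extends to the function field of the cone, and does not vanish on
`x₁ / x₀`. -/
theorem D_genericPoint_one_ne_zero {F : Type*} [Field F] (h2 : (2 : F) ≠ 0) (h3 : (3 : F) ≠ 0)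
    (C : SmoothPlaneQuartic F) : KaehlerDifferential.D F C.K (C.genericPoint 0 1) ≠ 0 := by
  set d : Derivation F (MvPolynomial (Fin 3) F) (MvPolynomial (Fin 3) F) :=
    mkDerivation F ![0, pderiv 2 C.form, -pderiv 1 C.form] with hd
  have hdf : d C.form = 0 := by
    have h := derivation_aeval d X C.form
    simp only [aeval_X_left, AlgHom.id_apply, Fin.sum_univ_three, hd, mkDerivation_X] at h
    simp only [hd, h, smul_eq_mul, Matrix.cons_val]
    ring
  have hker : ∀ p, Ideal.Quotient.mkₐ F (Ideal.span {C.form}) p = 0 →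
      Ideal.Quotient.mkₐ F (Ideal.span {C.form}) (d p) = 0 := by
    intro p hp
    simp only [Ideal.Quotient.mkₐ_eq_mk, Ideal.Quotient.eq_zero_iff_mem,
      Ideal.mem_span_singleton] at hp ⊢
    obtain ⟨q, rfl⟩ := hp
    rw [Derivation.leibniz, hdf, smul_zero, add_zero]
    exact ⟨_, rfl⟩
  let δ : Derivation F C.CoordRing C.CoordRing :=
    Derivation.liftOfSurjective (Ideal.Quotient.mkₐ_surjective F _) hker
  let δL : Derivation F C.CoordRing C.ConeField :=
    (Algebra.linearMap C.CoordRing C.ConeField).compDer δ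
  have := Algebra.FormallyEtale.of_isLocalization (Rₘ := C.ConeField)
    (nonZeroDivisors C.CoordRing)
  let ψ : Ω[C.ConeField⁄F] →ₗ[C.ConeField] C.ConeField :=
    (δL.liftKaehlerDifferential.liftBaseChange C.ConeField).comp
      (KaehlerDifferential.tensorKaehlerEquivOfFormallyEtale F C.CoordRing
        C.ConeField).symm.toLinearMap
  have hψ (i : Fin 3) : ψ (KaehlerDifferential.D F C.ConeField (C.coord i)) =
      aeval C.coord (d (X i)) := by
    have h1 : KaehlerDifferential.D F C.ConeField (C.coord i) =
        KaehlerDifferential.tensorKaehlerEquivOfFormallyEtale F C.CoordRing C.ConeField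
          (1 ⊗ₜ KaehlerDifferential.D F C.CoordRing (Ideal.Quotient.mk _ (X i))) := by
      simp [coord]
    have h2 : δ (Ideal.Quotient.mkₐ F (Ideal.span {C.form}) (X i)) =
        Ideal.Quotient.mkₐ F (Ideal.span {C.form}) (d (X i)) :=
      Derivation.liftOfSurjective_apply _ hker _
    simp only [Ideal.Quotient.mkₐ_eq_mk] at h2
    rw [h1, aeval_coord, ← h2]
    simp only [ψ, LinearMap.comp_apply, LinearEquiv.coe_coe, LinearEquiv.symm_apply_apply,
      LinearMap.liftBaseChange_tmul, one_smul, Derivation.liftKaehlerDifferential_comp_D]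
    rfl
  intro h
  have h4 := congrArg (KaehlerDifferential.map F F C.K C.ConeField) h
  rw [KaehlerDifferential.map_D, map_zero] at h4
  change KaehlerDifferential.D F C.ConeField (C.coord 1 / C.coord 0) = 0 at h4
  have h5 : C.coord 1 = (C.coord 1 / C.coord 0) * C.coord 0 :=
    (div_mul_cancel₀ _ (C.coord_ne_zero 0)).symm
  have h6 := hψ 1
  rw [h5, Derivation.leibniz, h4, smul_zero, add_zero, map_smul, hψ 0] at h6
  have h7 : aeval C.coord (pderiv 2 C.form) = 0 := by
    simpa [hd, mkDerivation_X] using h6.symm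
  exact C.form_not_dvd (n := 3) (by norm_num) C.isHomogeneous.pderiv
    (C.pderiv_two_form_ne_zero h2 h3) ((C.aeval_coord_eq_zero_iff _).1 h7)

end SmoothPlaneQuartic

/-! ### Cross products of a vector and its differential -/

/-- Let `w` be a triple of elements of `B`, one of which is `1`, generating `B` as an `R`-algebra,
such that the cross product of `w` and `dw` is `g • θ` in `Ω[A⁄R]`, where `g` is a unimodular triple
in `B`. Then `θ` generates the `B`-module of differentials that come from `B`. -/
theorem KaehlerDifferential.range_map_eq_span_of_cross {R B A : Type*} [CommRing R] [CommRing B]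
    [CommRing A] [Algebra R B] [Algebra R A] [Algebra B A] [IsScalarTower R B A] {w : Fin 3 → B}
    (hw : Function.Surjective (aeval w : MvPolynomial (Fin 3) R →ₐ[R] B)) {j : Fin 3}
    (hj : w j = 1) {g b : Fin 3 → B} (hbg : ∑ r, b r * g r = 1) {θ : Ω[A⁄R]}
    (h₂ : w 0 • KaehlerDifferential.map R R B A (KaehlerDifferential.D R B (w 1)) -
      w 1 • KaehlerDifferential.map R R B A (KaehlerDifferential.D R B (w 0)) = g 2 • θ)
    (h₀ : w 1 • KaehlerDifferential.map R R B A (KaehlerDifferential.D R B (w 2)) -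
      w 2 • KaehlerDifferential.map R R B A (KaehlerDifferential.D R B (w 1)) = g 0 • θ)
    (h₁ : w 2 • KaehlerDifferential.map R R B A (KaehlerDifferential.D R B (w 0)) -
      w 0 • KaehlerDifferential.map R R B A (KaehlerDifferential.D R B (w 2)) = g 1 • θ) :
    LinearMap.range (KaehlerDifferential.map R R B A) = Submodule.span B {θ} := by
  have hgθ (r : Fin 3) : g r • θ ∈ Submodule.span B {θ} :=
    Submodule.smul_mem _ _ (Submodule.mem_span_singleton_self θ)
  apply le_antisymm
  · have hcross : ∀ p q : Fin 3,
        w p • KaehlerDifferential.map R R B A (KaehlerDifferential.D R B (w q)) -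
          w q • KaehlerDifferential.map R R B A (KaehlerDifferential.D R B (w p)) ∈
            Submodule.span B {θ} := by
      have hneg {ξ ζ : Ω[A⁄R]} {r : Fin 3} (h : ξ - ζ = g r • θ) :
          ζ - ξ ∈ Submodule.span B {θ} := by
        rw [← neg_sub, h]
        exact neg_mem (hgθ r)
      have hself (ξ : Ω[A⁄R]) : ξ - ξ ∈ Submodule.span B {θ} := by
        rw [sub_self]
        exact zero_mem _
      intro p q
      fin_cases p <;> fin_cases q
      exacts [hself _, h₂ ▸ hgθ 2, hneg h₁, hneg h₂, hself _, h₀ ▸ hgθ 0, h₁ ▸ hgθ 1, hneg h₀,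
        hself _]
    -- As `w j = 1`, the differential of `w i` is one of the expressions in `hcross`.
    have hD (i : Fin 3) : KaehlerDifferential.map R R B A (KaehlerDifferential.D R B (w i)) ∈
        Submodule.span B {θ} := by
      have h := hcross j i
      rwa [hj, Derivation.map_one_eq_zero, map_zero, smul_zero, sub_zero, one_smul] at h
    rw [LinearMap.range_eq_map, ← KaehlerDifferential.span_range_derivation, Submodule.map_span,
      Submodule.span_le]
    rintro _ ⟨_, ⟨y, rfl⟩, rfl⟩
    obtain ⟨p, rfl⟩ := hw y
    rw [derivation_aeval, map_sum]
    refine sum_mem fun i _ => ?_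
    rw [map_smul]
    exact Submodule.smul_mem _ _ (hD i)
  · rw [Submodule.span_singleton_le_iff_mem]
    have hθ : θ = b 0 • g 0 • θ + b 1 • g 1 • θ + b 2 • g 2 • θ := by
      rw [Fin.sum_univ_three] at hbg
      rw [smul_smul, smul_smul, smul_smul, ← add_smul, ← add_smul, hbg, one_smul]
    rw [hθ, ← h₀, ← h₁, ← h₂]
    simp only [← map_smul, ← map_sub, ← map_add]
    exact LinearMap.mem_range_self _ _

/-- The version of `KaehlerDifferential.range_map_eq_span_of_cross` for a subalgebra. -/
theorem KaehlerDifferential.mem_range_map_iff_of_cross {R A : Type*} [CommRing R] [CommRing A]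
    [Algebra R A] {S : Subalgebra R A} {w : Fin 3 → A}
    (hS : S = (aeval w : MvPolynomial (Fin 3) R →ₐ[R] A).range) {j : Fin 3} (hj : w j = 1)
    {g b : Fin 3 → A} (hg : ∀ r, g r ∈ S) (hb : ∀ r, b r ∈ S) (hbg : ∑ r, b r * g r = 1)
    {θ : Ω[A⁄R]}
    (h₂ : w 0 • KaehlerDifferential.D R A (w 1) - w 1 • KaehlerDifferential.D R A (w 0) = g 2 • θ)
    (h₀ : w 1 • KaehlerDifferential.D R A (w 2) - w 2 • KaehlerDifferential.D R A (w 1) = g 0 • θ)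
    (h₁ : w 2 • KaehlerDifferential.D R A (w 0) - w 0 • KaehlerDifferential.D R A (w 2) = g 1 • θ)
    (ω : Ω[A⁄R]) :
    ω ∈ LinearMap.range (KaehlerDifferential.map R R S A) ↔ ∃ a ∈ S, a • θ = ω := by
  have hSw (i : Fin 3) : w i ∈ S := by
    rw [hS]
    exact ⟨X i, aeval_X w i⟩
  have hsurj : Function.Surjective
      (aeval (fun i => (⟨w i, hSw i⟩ : S)) : MvPolynomial (Fin 3) R →ₐ[R] S) := by
    rintro ⟨y, hy⟩
    have hy' := hy
    rw [hS] at hy'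
    obtain ⟨p, hp⟩ := hy'
    refine ⟨p, Subtype.ext ?_⟩
    exact (MvPolynomial.comp_aeval_apply (fun i => (⟨w i, hSw i⟩ : S)) S.val p).trans hp
  have hD (i : Fin 3) : KaehlerDifferential.map R R S A (KaehlerDifferential.D R S ⟨w i, hSw i⟩) =
      KaehlerDifferential.D R A (w i) := KaehlerDifferential.map_D R R S A _
  have hbg' : ∑ r, (⟨b r, hb r⟩ : S) * ⟨g r, hg r⟩ = 1 := Subtype.ext (by simpa using hbg)
  have h := KaehlerDifferential.range_map_eq_span_of_cross hsurj
    (j := j) (Subtype.ext hj) hbg' (θ := θ) (by rw [hD, hD]; exact h₂) (by rw [hD, hD]; exact h₀)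
    (by rw [hD, hD]; exact h₁)
  rw [h, Submodule.mem_span_singleton]
  exact ⟨fun ⟨a, ha⟩ => ⟨a, a.2, ha⟩, fun ⟨a, ha, h⟩ => ⟨⟨a, ha⟩, h⟩⟩

/-- The cross product of `c v` and `d(c v)` is `c ^ 2` times that of `v` and `dv`, which is computed
here for `v = (1, v₁, v₂)` from a relation `g₁ dv₁ + g₂ dv₂ = 0`. -/
theorem Derivation.cross_mul {R A M : Type*} [CommRing R] [CommRing A] [Algebra R A]
    [AddCommGroup M] [Module R M] [Module A M] (D : Derivation R A M) {v g : Fin 3 → A} {η : M}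
    (hv : v 0 = 1) (hg : v 0 * g 0 + v 1 * g 1 + v 2 * g 2 = 0) (h₁ : D (v 1) = g 2 • η)
    (h₂ : D (v 2) = -g 1 • η) (c : A) {p q r : Fin 3}
    (hpqr : (p, q, r) = (0, 1, 2) ∨ (p, q, r) = (1, 2, 0) ∨ (p, q, r) = (2, 0, 1)) :
    (c * v p) • D (c * v q) - (c * v q) • D (c * v p) = (c ^ 2 * g r) • η := by
  have h₀ : D (v 0) = 0 := by rw [hv, Derivation.map_one_eq_zero]
  have h : (c * v p) • D (c * v q) - (c * v q) • D (c * v p) =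
      c ^ 2 • (v p • D (v q) - v q • D (v p)) := by
    rw [Derivation.leibniz, Derivation.leibniz]
    module
  have hg' : g 0 = -(v 1 * g 1) - v 2 * g 2 := by
    rw [hv] at hg
    linear_combination hg
  rw [h, mul_smul]
  congr 1
  rcases hpqr with h | h | h <;> simp only [Prod.mk.injEq] at h <;> obtain ⟨rfl, rfl, rfl⟩ := h
  · rw [h₀, h₁, hv]
    module
  · rw [h₁, h₂, hg']
    module
  · rw [h₀, h₂, hv]
    module

namespace SmoothPlaneQuartic

/-! ### The Poincaré residue -/

/-- The Poincaré residue `dx₁ / (∂f/∂x₂)` in the affine coordinates with `x₀ = 1`: the holomorphic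
differential that corresponds to the linear form `x₀`. -/
noncomputable def poincareResidue {F : Type*} [Field F] (C : SmoothPlaneQuartic F) : Ω[C.K⁄F] :=
  (aeval (C.genericPoint 0) (pderiv 2 C.form))⁻¹ • KaehlerDifferential.D F C.K (C.genericPoint 0 1)

theorem poincareResidue_ne_zero {F : Type*} [Field F] (h2 : (2 : F) ≠ 0) (h3 : (3 : F) ≠ 0)
    (C : SmoothPlaneQuartic F) : C.poincareResidue ≠ 0 :=
  smul_ne_zero (inv_ne_zero (C.aeval_pderiv_two_ne_zero h2 h3 0))
    (C.D_genericPoint_one_ne_zero h2 h3)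

theorem D_genericPoint_one {F : Type*} [Field F] (h2 : (2 : F) ≠ 0) (h3 : (3 : F) ≠ 0)
    (C : SmoothPlaneQuartic F) : KaehlerDifferential.D F C.K (C.genericPoint 0 1) =
      aeval (C.genericPoint 0) (pderiv 2 C.form) • C.poincareResidue := by
  rw [poincareResidue, smul_inv_smul₀ (C.aeval_pderiv_two_ne_zero h2 h3 0)]

theorem D_genericPoint_two {F : Type*} [Field F] (h2 : (2 : F) ≠ 0) (h3 : (3 : F) ≠ 0)
    (C : SmoothPlaneQuartic F) : KaehlerDifferential.D F C.K (C.genericPoint 0 2) =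
      (-aeval (C.genericPoint 0) (pderiv 1 C.form)) • C.poincareResidue := by
  have h := derivation_aeval (KaehlerDifferential.D F C.K) (C.genericPoint 0) C.form
  rw [aeval_genericPoint_form, map_zero, Fin.sum_univ_three, genericPoint_self,
    Derivation.map_one_eq_zero, smul_zero, zero_add, C.D_genericPoint_one h2 h3] at h
  apply smul_right_injective _ (C.aeval_pderiv_two_ne_zero h2 h3 0)
  simp only
  rw [eq_neg_of_add_eq_zero_right h.symm, smul_smul, smul_smul, ← neg_smul]
  congr 1
  ring

/-- If `(p, q, r)` is a cyclic permutation of `(0, 1, 2)`, then `v_p dv_q - v_q dv_p` is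
`∂f/∂x_r (v)` times a differential, which does not depend on the permutation, but changes by the
factor `x_j / x₀` from the chart `x₀ ≠ 0` to the chart `x_j ≠ 0`. -/
theorem wedge_genericPoint {F : Type*} [Field F] (h2 : (2 : F) ≠ 0) (h3 : (3 : F) ≠ 0)
    (C : SmoothPlaneQuartic F) (j p q r : Fin 3)
    (hpqr : (p, q, r) = (0, 1, 2) ∨ (p, q, r) = (1, 2, 0) ∨ (p, q, r) = (2, 0, 1)) :
    C.genericPoint j p • KaehlerDifferential.D F C.K (C.genericPoint j q) -
        C.genericPoint j q • KaehlerDifferential.D F C.K (C.genericPoint j p) =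
      (aeval (C.genericPoint j) (pderiv r C.form) * C.genericPoint 0 j) • C.poincareResidue := by
  have hg := congrArg (aeval (C.genericPoint 0)) C.isHomogeneous.sum_X_mul_pderiv
  rw [map_nsmul, aeval_genericPoint_form, smul_zero, Fin.sum_univ_three] at hg
  simp only [map_add, map_mul, aeval_X] at hg
  have h := (KaehlerDifferential.D F C.K).cross_mul
    (g := fun r => aeval (C.genericPoint 0) (pderiv r C.form)) (C.genericPoint_self 0) hg
    (C.D_genericPoint_one h2 h3) (C.D_genericPoint_two h2 h3) (C.genericPoint 0 j)⁻¹ hpqr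
  have hj := C.genericPoint_ne_zero j 0
  rw [C.genericPoint_eq_mul j, C.isHomogeneous.pderiv.aeval_mul]
  refine h.trans (congrArg (· • C.poincareResidue) ?_)
  simp only [show 4 - 1 = 3 from rfl]
  field_simp

/-! ### Holomorphic differentials -/

/-- The regular differentials on the chart `x_j ≠ 0` are the multiples of `x_j / x₀` times the
Poincaré residue, which is the Poincaré residue in the coordinates with `x_j = 1`, by regular
functions. -/
theorem mem_range_map_chart_iff {F : Type*} [Field F] (h2 : (2 : F) ≠ 0) (h3 : (3 : F) ≠ 0)
    (C : SmoothPlaneQuartic F) (j : Fin 3) (ω : Ω[C.K⁄F]) :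
    ω ∈ LinearMap.range (KaehlerDifferential.map F F (C.chart j) C.K) ↔
      ∃ a ∈ C.chart j, (a * C.genericPoint 0 j) • C.poincareResidue = ω := by
  obtain ⟨b, hb⟩ := C.exists_sum_mul_pderiv_eq_one j
  have hw (p q r : Fin 3) (h : (p, q, r) = (0, 1, 2) ∨ (p, q, r) = (1, 2, 0) ∨
      (p, q, r) = (2, 0, 1)) := (C.wedge_genericPoint h2 h3 j p q r h).trans (mul_smul _ _ _)
  rw [KaehlerDifferential.mem_range_map_iff_of_cross (C.chart_eq_range j) (C.genericPoint_self j)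
    (fun r => C.aeval_genericPoint_mem_chart j (pderiv r C.form)) (fun r => (b r).2) hb
    (hw 0 1 2 (by simp)) (hw 1 2 0 (by simp)) (hw 2 0 1 (by simp))]
  simp only [mul_smul]

/-- The holomorphic differentials are the products of the Poincaré residue and the rational
functions `l / x₀` for linear forms `l`. -/
theorem mem_holomorphicDifferentials_iff {F : Type*} [Field F] (h2 : (2 : F) ≠ 0)
    (h3 : (3 : F) ≠ 0) (C : SmoothPlaneQuartic F) (ω : Ω[C.K⁄F]) :
    ω ∈ C.holomorphicDifferentials ↔
      ∃ c : Fin 3 → F, ω = aeval (C.genericPoint 0) (linearForm c) • C.poincareResidue := by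
  have hmem : ω ∈ C.holomorphicDifferentials ↔
      ∀ j, ∃ a ∈ C.chart j, (a * C.genericPoint 0 j) • C.poincareResidue = ω := by
    rw [holomorphicDifferentials, Submodule.mem_iInf]
    exact forall_congr' fun j => C.mem_range_map_chart_iff h2 h3 j ω
  rw [hmem]
  constructor
  · intro h
    choose a ha haω using h
    have h0 := haω 0
    rw [genericPoint_self, mul_one] at h0
    obtain ⟨c, hc⟩ := C.exists_linearForm_of_mem_chart fun j => ⟨a j, ha j,
      smul_left_injective C.K (C.poincareResidue_ne_zero h2 h3) (h0.trans (haω j).symm)⟩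
    exact ⟨c, by rw [← h0, hc]⟩
  · rintro ⟨c, rfl⟩ j
    refine ⟨_, C.aeval_genericPoint_mem_chart j (linearForm c), ?_⟩
    have hj := C.genericPoint_ne_zero j 0
    rw [C.genericPoint_eq_mul j, (linearForm_isHomogeneous c).aeval_mul]
    congr 1
    field_simp

/-- The linear map that sends the coefficients of a linear form `l` to the product of the Poincaré
residue and `l / x₀`. -/
noncomputable def linearFormResidue {F : Type*} [Field F] (C : SmoothPlaneQuartic F) :
    (Fin 3 → F) →ₗ[F] Ω[C.K⁄F] where
  toFun c := aeval (C.genericPoint 0) (linearForm c) • C.poincareResidue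
  map_add' c d := by simp [add_smul, Finset.sum_add_distrib]
  map_smul' a c := by
    rw [RingHom.id_apply, ← smul_assoc]
    simp [Finset.smul_sum, smul_smul]

theorem linearFormResidue_injective {F : Type*} [Field F] (h2 : (2 : F) ≠ 0) (h3 : (3 : F) ≠ 0)
    (C : SmoothPlaneQuartic F) : Function.Injective C.linearFormResidue := by
  rw [injective_iff_map_eq_zero]
  intro c hc
  have h := (smul_eq_zero.1 hc).resolve_right (C.poincareResidue_ne_zero h2 h3)
  have hl : linearForm c = 0 := by
    by_contra h0
    exact C.aeval_genericPoint_ne_zero (linearForm_isHomogeneous c) (by norm_num) h0 0 h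
  funext i
  rw [← coeff_linearForm c i, hl, coeff_zero, Pi.zero_apply]

theorem range_linearFormResidue {F : Type*} [Field F] (h2 : (2 : F) ≠ 0) (h3 : (3 : F) ≠ 0)
    (C : SmoothPlaneQuartic F) :
    LinearMap.range C.linearFormResidue = C.holomorphicDifferentials := by
  ext ω
  rw [C.mem_holomorphicDifferentials_iff h2 h3, LinearMap.mem_range]
  exact exists_congr fun c => eq_comm

theorem finrank_holomorphicDifferentials {F : Type*} [Field F] (h2 : (2 : F) ≠ 0)
    (h3 : (3 : F) ≠ 0) (C : SmoothPlaneQuartic F) :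
    Module.finrank F C.holomorphicDifferentials = 3 := by
  rw [← C.range_linearFormResidue h2 h3,
    LinearMap.finrank_range_of_inj (C.linearFormResidue_injective h2 h3), Module.finrank_fin_fun]

end SmoothPlaneQuartic

/-! ### Linear changes of coordinates -/

namespace MvPolynomial

theorem linearForm_one {R σ : Type*} [CommRing R] [Fintype σ] [DecidableEq σ] (j : σ) :
    linearForm ((1 : Matrix σ σ R) j) = X j := by
  simp [linearForm, Matrix.one_apply, apply_ite]

theorem pderiv_linearForm {R σ : Type*} [CommRing R] [Fintype σ] (c : σ → R) (i : σ) :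
    pderiv i (linearForm c) = C (c i) := by
  classical
  simp [linearForm, pderiv_X, Pi.single_apply]

/-- The substitution of the linear forms given by the rows of a matrix for the variables. -/
noncomputable def linearSubst {R σ : Type*} [CommRing R] [Fintype σ] (M : Matrix σ σ R) :
    MvPolynomial σ R →ₐ[R] MvPolynomial σ R :=
  aeval fun j => linearForm (M j)

theorem linearSubst_linearForm {R σ : Type*} [CommRing R] [Fintype σ] (M : Matrix σ σ R)
    (c : σ → R) : linearSubst M (linearForm c) = linearForm (Matrix.vecMul c M) := by
  simp only [linearSubst, linearForm, map_sum, map_mul, aeval_X, algHom_C, algebraMap_eq,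
    Matrix.vecMul, dotProduct, Finset.mul_sum, Finset.sum_mul, mul_assoc]
  rw [Finset.sum_comm]

theorem linearSubst_linearSubst {R σ : Type*} [CommRing R] [Fintype σ] [DecidableEq σ]
    {M N : Matrix σ σ R} (h : N * M = 1) (p : MvPolynomial σ R) :
    linearSubst M (linearSubst N p) = p := by
  have h1 : (linearSubst M).comp (linearSubst N) = AlgHom.id R (MvPolynomial σ R) := by
    ext1 j
    rw [AlgHom.comp_apply, AlgHom.id_apply, linearSubst.eq_def N, aeval_X, linearSubst_linearForm,
      ← linearForm_one, ← h]
    rfl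
  exact DFunLike.congr_fun h1 p

theorem IsHomogeneous.linearSubst {R σ : Type*} [CommRing R] [Fintype σ] (M : Matrix σ σ R)
    {p : MvPolynomial σ R} {n : ℕ} (hp : p.IsHomogeneous n) :
    (linearSubst M p).IsHomogeneous n := by
  have h := hp.aeval (fun j => linearForm (M j)) fun j => linearForm_isHomogeneous (M j)
  rwa [one_mul] at h

theorem aeval_linearSubst {R σ A : Type*} [CommRing R] [Fintype σ] [CommRing A] [Algebra R A]
    (M : Matrix σ σ R) (v : σ → A) (p : MvPolynomial σ R) :
    aeval v (linearSubst M p) = aeval (fun j => aeval v (linearForm (M j))) p := by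
  have h : (aeval v : MvPolynomial σ R →ₐ[R] A).comp (linearSubst M) =
      aeval (fun j => aeval v (linearForm (M j))) := by
    ext1 j
    rw [AlgHom.comp_apply, linearSubst, aeval_X, aeval_X]
  exact DFunLike.congr_fun h p

/-- The column `i` of the adjugate of `M` is mapped by `M` to a multiple of the basis vector `i`, so
the derivative along it of a form in the new coordinates is a multiple of a partial derivative. -/
theorem dirDeriv_adjugate_linearSubst {R σ : Type*} [CommRing R] [Fintype σ] [DecidableEq σ]
    (M : Matrix σ σ R) (i : σ) (p : MvPolynomial σ R) :
    dirDeriv (fun j => M.adjugate j i) (linearSubst M p) =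
      C M.det * linearSubst M (pderiv i p) := by
  have h (j : σ) : pderiv j (linearSubst M p) =
      ∑ k, linearSubst M (pderiv k p) * C (M k j) := by
    have := derivation_aeval (pderiv j) (fun k => linearForm (M k)) p
    simp only [pderiv_linearForm, smul_eq_mul] at this
    exact this
  have hadj (k : σ) : ∑ j, M k j * M.adjugate j i = if k = i then M.det else 0 := by
    rw [← Matrix.mul_apply, Matrix.mul_adjugate]
    simp [Matrix.one_apply]
  calc dirDeriv (fun j => M.adjugate j i) (linearSubst M p)
      = ∑ k, linearSubst M (pderiv k p) * C (∑ j, M k j * M.adjugate j i) := by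
        simp only [dirDeriv, h, Finset.mul_sum, map_sum, map_mul]
        rw [Finset.sum_comm]
        exact Finset.sum_congr rfl fun _ _ => Finset.sum_congr rfl fun _ _ => by ring
    _ = _ := by simp [hadj, apply_ite, mul_comm]

end MvPolynomial

/-- The cross product of `M v` and `d(M v)`, for a matrix `M` of constants, is obtained from that
of `v` and `dv` by the cofactor matrix of `M`; here its last coordinate. The cross product of
`v = (1, v₁, v₂)` and `dv` is presented as `g • η`, as in `Derivation.cross_mul`. -/
theorem Derivation.cross_linearForm {R A M : Type*} [CommRing R] [CommRing A] [Algebra R A]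
    [AddCommGroup M] [Module R M] [Module A M] [IsScalarTower R A M] (D : Derivation R A M)
    {v g : Fin 3 → A} {η : M}
    (hv : v 0 = 1) (hg : v 0 * g 0 + v 1 * g 1 + v 2 * g 2 = 0) (h₁ : D (v 1) = g 2 • η)
    (h₂ : D (v 2) = -g 1 • η) (N : Matrix (Fin 3) (Fin 3) R) :
    aeval v (linearForm (N 0)) • D (aeval v (linearForm (N 1))) -
      aeval v (linearForm (N 1)) • D (aeval v (linearForm (N 0))) =
        (∑ i, algebraMap R A (N.adjugate i 2) * g i) • η := by
  have h₀ : D (v 0) = 0 := by rw [hv, Derivation.map_one_eq_zero]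
  have hD (c : Fin 3 → R) : D (aeval v (linearForm c)) =
      (algebraMap R A (c 1) * g 2 - algebraMap R A (c 2) * g 1) • η := by
    rw [derivation_aeval, Fin.sum_univ_three, h₀, h₁, h₂]
    simp only [pderiv_linearForm, aeval_C]
    module
  have hg' : g 0 = -(v 1 * g 1) - v 2 * g 2 := by
    rw [hv] at hg
    linear_combination hg
  rw [hD, hD, smul_smul, smul_smul, ← sub_smul]
  congr 1
  simp only [aeval_linearForm, Fin.sum_univ_three, hv, hg', Matrix.adjugate_fin_three,
    Algebra.smul_def, Matrix.of_apply, Matrix.cons_val, map_add, map_sub, map_neg, map_mul]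
  ring

/-- The differential of an affine coordinate `z 1` when `(1, z 1, z 2)` is proportional to `w`. -/
theorem Derivation.sq_smul_eq_cross {R A M : Type*} [CommRing R] [CommRing A] [Algebra R A]
    [AddCommGroup M] [Module R M] [Module A M] (D : Derivation R A M) {w₀ w₁ z : A}
    (h : w₁ = z * w₀) : w₀ ^ 2 • D z = w₀ • D w₁ - w₁ • D w₀ := by
  rw [h, Derivation.leibniz]
  module

theorem div_mul_eq_of_cubic_rescaling {K : Type*} [Field K] {d w k c A : K}
    (hw : w ≠ 0) (hc : c ≠ 0) (hA : A ≠ 0) (h : d * (w ^ 3 * k) = c * A) (l : K) :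
    l / k * ((w ^ 2)⁻¹ * A) = d / c * (w ^ 1 * l) := by
  have hk : k ≠ 0 := by
    rintro rfl
    rw [mul_zero, mul_zero] at h
    exact mul_ne_zero hc hA h.symm
  field_simp
  linear_combination (-l) * h

namespace SmoothPlaneQuartic

/-! ### Canonical models -/

/-- The holomorphic differentials in a basis are the multiples of the Poincaré residue by linear
forms with linearly independent coefficient vectors. -/
theorem exists_matrix_of_basis {F : Type*} [Field F] (h2 : (2 : F) ≠ 0) (h3 : (3 : F) ≠ 0)
    (C : SmoothPlaneQuartic F) (b : Module.Basis (Fin 3) F C.holomorphicDifferentials) :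
    ∃ M : Matrix (Fin 3) (Fin 3) F, IsUnit M ∧
      ∀ j, (b j : Ω[C.K⁄F]) = aeval (C.genericPoint 0) (linearForm (M j)) • C.poincareResidue := by
  choose M hM using fun j => (C.mem_holomorphicDifferentials_iff h2 h3 (b j)).1 (b j).2
  refine ⟨Matrix.of M, ?_, hM⟩
  rw [← Matrix.linearIndependent_rows_iff_isUnit]
  have hb : LinearIndependent F fun j => (b j : Ω[C.K⁄F]) :=
    b.linearIndependent.map' C.holomorphicDifferentials.subtype (Submodule.ker_subtype _)
  refine LinearIndependent.of_comp C.linearFormResidue ?_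
  have h : C.linearFormResidue ∘ (Matrix.of M).row = fun j => (b j : Ω[C.K⁄F]) :=
    funext fun j => (hM j).symm
  rwa [h]

section

variable {F : Type*} [Field F] {C : SmoothPlaneQuartic F} {M : Matrix (Fin 3) (Fin 3) F}

theorem aeval_linearForm_ne_zero (hM : IsUnit M) (j : Fin 3) :
    aeval (C.genericPoint 0) (linearForm (M j)) ≠ 0 := by
  refine C.aeval_genericPoint_ne_zero (linearForm_isHomogeneous _) (by norm_num) (fun h => ?_) 0
  have h1 : M j = 0 := funext fun i => by rw [← coeff_linearForm (M j) i, h]; simp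
  exact (Matrix.linearIndependent_rows_iff_isUnit.2 hM).ne_zero j h1

/-- The equation of the image of the canonical map becomes a multiple of the given equation of
the curve after the change of coordinates. -/
theorem linearSubst_eq_of_aeval_eq_zero (hM : IsUnit M) {z : Fin 3 → C.K}
    (hz : ∀ j, aeval (C.genericPoint 0) (linearForm (M j)) =
      z j * aeval (C.genericPoint 0) (linearForm (M 0)))
    {k : MvPolynomial (Fin 3) F} (hk : k.IsHomogeneous 4) (hk0 : k ≠ 0) (hzk : aeval z k = 0) :
    ∃ c : F, c ≠ 0 ∧ linearSubst M k = MvPolynomial.C c * C.form := by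
  have h1 : aeval (C.genericPoint 0) (linearSubst M k) = 0 := by
    rw [aeval_linearSubst, funext hz]
    simp only [mul_comm (z _)]
    rw [hk.aeval_mul, hzk, mul_zero]
  obtain ⟨c, hc⟩ := C.exists_eq_C_mul_of_form_dvd (hk.linearSubst M)
    ((C.aeval_genericPoint_eq_zero_iff (hk.linearSubst M) 0).1 h1)
  refine ⟨c, ?_, hc⟩
  rintro rfl
  apply hk0
  rw [← linearSubst_linearSubst (Matrix.mul_nonsing_inv M ((Matrix.isUnit_iff_isUnit_det M).1 hM)) k,
    hc, map_zero, zero_mul, map_zero]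

theorem exists_isCanonicalModel (b : Module.Basis (Fin 3) F C.holomorphicDifferentials)
    (hM : IsUnit M) (hb : ∀ j, (b j : Ω[C.K⁄F]) =
      aeval (C.genericPoint 0) (linearForm (M j)) • C.poincareResidue) :
    ∃ z k, C.IsCanonicalModel b z k := by
  have h0 : aeval (C.genericPoint 0) (linearForm (M 0)) ≠ 0 := aeval_linearForm_ne_zero hM 0
  have hk : linearSubst M (linearSubst M⁻¹ C.form) = C.form := linearSubst_linearSubst
    (Matrix.nonsing_inv_mul M ((Matrix.isUnit_iff_isUnit_det M).1 hM)) C.form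
  refine ⟨fun j => (aeval (C.genericPoint 0) (linearForm (M 0)))⁻¹ *
    aeval (C.genericPoint 0) (linearForm (M j)), linearSubst M⁻¹ C.form, ?_,
    C.isHomogeneous.linearSubst _, ?_, ?_⟩
  · intro j
    rw [hb, hb, smul_smul]
    congr 1
    field_simp
  · intro h
    rw [h, map_zero] at hk
    exact C.irreducible.ne_zero hk.symm
  · rw [(C.isHomogeneous.linearSubst M⁻¹).aeval_mul, ← aeval_linearSubst, hk,
      aeval_genericPoint_form, mul_zero]

set_option maxHeartbeats 1000000 in
/-- The map `l ↦ l dz₁ / (∂k/∂z₂)` in the coordinates given by `M` is the multiplication of the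
Poincaré residue by `l`, written in the original coordinates, up to a nonzero constant. -/
theorem residueMap_eq (h2 : (2 : F) ≠ 0) (h3 : (3 : F) ≠ 0) (hM : IsUnit M) {z : Fin 3 → C.K}
    (hz : ∀ j, aeval (C.genericPoint 0) (linearForm (M j)) =
      z j * aeval (C.genericPoint 0) (linearForm (M 0)))
    {k : MvPolynomial (Fin 3) F} (hk : k.IsHomogeneous 4) {c : F} (hc : c ≠ 0)
    (hkc : linearSubst M k = MvPolynomial.C c * C.form) (e : Fin 3 → F) :
    C.residueMap z k ⟨linearForm e, linearForm_isHomogeneous e⟩ =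
      (M.det / c) • C.linearFormResidue (Matrix.vecMul e M) := by
  have hdet : M.det ≠ 0 := ((Matrix.isUnit_iff_isUnit_det M).1 hM).ne_zero
  have hw0 : aeval (C.genericPoint 0) (linearForm (M 0)) ≠ 0 := aeval_linearForm_ne_zero hM 0
  set w : Fin 3 → C.K := fun j => aeval (C.genericPoint 0) (linearForm (M j)) with hw
  have hzw {p : MvPolynomial (Fin 3) F} {n : ℕ} (hp : p.IsHomogeneous n) :
      aeval (C.genericPoint 0) (linearSubst M p) = w 0 ^ n * aeval z p := by
    rw [aeval_linearSubst, ← hp.aeval_mul]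
    congr 2
    funext j
    rw [mul_comm]
    exact hz j
  set A := aeval (C.genericPoint 0) (dirDeriv (fun i => M.adjugate i 2) C.form) with hA
  have hA0 : A ≠ 0 := by
    refine C.aeval_dirDeriv_ne_zero h2 h3 (fun h => hdet ?_) 0
    have h1 : (M * M.adjugate) 2 2 = 0 := by
      rw [Matrix.mul_apply]
      exact Finset.sum_eq_zero fun i _ => by rw [congrFun h i, Pi.zero_apply, mul_zero]
    simpa [Matrix.mul_adjugate] using h1
  -- The denominator of the residue map.
  have hden : algebraMap F C.K M.det * (w 0 ^ 3 * aeval z (pderiv 2 k)) =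
      algebraMap F C.K c * A := by
    have h1 := congrArg (aeval (C.genericPoint 0)) (dirDeriv_adjugate_linearSubst M 2 k)
    rw [map_mul, aeval_C, hzw hk.pderiv, hkc] at h1
    rw [← h1, hA, ← aeval_C (C.genericPoint 0) c, ← map_mul]
    congr 1
    simp only [dirDeriv, pderiv_C_mul, Finset.mul_sum]
    exact Finset.sum_congr rfl fun _ _ => by ring
  -- The differential in the numerator.
  have hnum : w 0 ^ 2 • KaehlerDifferential.D F C.K (z 1) = A • C.poincareResidue := by
    have hg := congrArg (aeval (C.genericPoint 0)) C.isHomogeneous.sum_X_mul_pderiv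
    rw [map_nsmul, aeval_genericPoint_form, smul_zero, Fin.sum_univ_three] at hg
    simp only [map_add, map_mul, aeval_X] at hg
    have h1 := (KaehlerDifferential.D F C.K).cross_linearForm
      (g := fun r => aeval (C.genericPoint 0) (pderiv r C.form)) (C.genericPoint_self 0) hg
      (C.D_genericPoint_one h2 h3) (C.D_genericPoint_two h2 h3) M
    refine ((KaehlerDifferential.D F C.K).sq_smul_eq_cross (hz 1)).trans (h1.trans ?_)
    simp only [hA, dirDeriv, map_sum, map_mul, aeval_C]
  have hc' : algebraMap F C.K c ≠ 0 := by simpa using hc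
  have hl := hzw (linearForm_isHomogeneous e)
  rw [linearSubst_linearForm] at hl
  change (aeval z (linearForm e) / aeval z (pderiv 2 k)) • KaehlerDifferential.D F C.K (z 1) =
    (M.det / c) • aeval (C.genericPoint 0) (linearForm (Matrix.vecMul e M)) • C.poincareResidue
  have hDz : KaehlerDifferential.D F C.K (z 1) = ((w 0 ^ 2)⁻¹ * A) • C.poincareResidue := by
    rw [mul_smul, ← hnum, inv_smul_smul₀ (pow_ne_zero 2 hw0)]
  rw [hDz, hl, ← algebraMap_smul C.K (M.det / c), smul_smul, smul_smul, map_div₀]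
  congr 1
  exact div_mul_eq_of_cubic_rescaling hw0 hc' hA0 hden _

theorem residueMap_injective_and_range (h2 : (2 : F) ≠ 0) (h3 : (3 : F) ≠ 0) (hM : IsUnit M)
    {z : Fin 3 → C.K}
    (hz : ∀ j, aeval (C.genericPoint 0) (linearForm (M j)) =
      z j * aeval (C.genericPoint 0) (linearForm (M 0)))
    {k : MvPolynomial (Fin 3) F} (hk : k.IsHomogeneous 4) (hk0 : k ≠ 0) (hzk : aeval z k = 0) :
    Function.Injective (C.residueMap z k) ∧
      LinearMap.range (C.residueMap z k) = C.holomorphicDifferentials := by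
  obtain ⟨c, hc, hkc⟩ := linearSubst_eq_of_aeval_eq_zero hM hz hk hk0 hzk
  have hres := residueMap_eq h2 h3 hM hz hk hc hkc
  have hunit := (Matrix.isUnit_iff_isUnit_det M).1 hM
  have hdet : M.det / c ≠ 0 := div_ne_zero hunit.ne_zero hc
  constructor
  · rw [injective_iff_map_eq_zero]
    rintro ⟨l, hl⟩ h
    obtain ⟨e, rfl⟩ := IsHomogeneous.exists_eq_linearForm hl
    rw [hres, smul_eq_zero_iff_right hdet] at h
    have h1 := (injective_iff_map_eq_zero _).1 (C.linearFormResidue_injective h2 h3) _ h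
    have h4 : e = 0 := Matrix.vecMul_injective_iff_isUnit.2 hM (h1.trans (Matrix.zero_vecMul M).symm)
    exact Subtype.ext (by simp [h4, linearForm])
  · rw [← C.range_linearFormResidue h2 h3]
    apply le_antisymm
    · rintro _ ⟨⟨l, hl⟩, rfl⟩
      obtain ⟨e, rfl⟩ := IsHomogeneous.exists_eq_linearForm hl
      rw [hres]
      exact Submodule.smul_mem _ _ (LinearMap.mem_range_self _ _)
    · rintro _ ⟨d, rfl⟩
      refine ⟨⟨_, linearForm_isHomogeneous ((M.det / c)⁻¹ • Matrix.vecMul d M⁻¹)⟩, ?_⟩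
      rw [hres, Matrix.smul_vecMul, Matrix.vecMul_vecMul, Matrix.nonsing_inv_mul M hunit,
        Matrix.vecMul_one, map_smul, smul_inv_smul₀ hdet]

end

theorem canonicalModel_residueMap {F : Type*} [Field F] (h2 : (2 : F) ≠ 0) (h3 : (3 : F) ≠ 0)
    (C : SmoothPlaneQuartic F) (b : Module.Basis (Fin 3) F C.holomorphicDifferentials) :
    (∃ z k, C.IsCanonicalModel b z k) ∧
      ∀ z k, C.IsCanonicalModel b z k →
        Function.Injective (C.residueMap z k) ∧
        LinearMap.range (C.residueMap z k) = C.holomorphicDifferentials := by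
  obtain ⟨M, hM, hb⟩ := C.exists_matrix_of_basis h2 h3 b
  refine ⟨exists_isCanonicalModel b hM hb, fun z k h => ?_⟩
  refine residueMap_injective_and_range h2 h3 hM (fun j => ?_) h.isHomogeneous h.ne_zero h.vanishes
  have h1 := h.coordinates j
  rw [hb, hb, smul_smul] at h1
  exact smul_left_injective C.K (C.poincareResidue_ne_zero h2 h3) h1

end SmoothPlaneQuartic

theorem mainTheorem6 {F : Type*} [Field F] (h2 : (2 : F) ≠ 0) (h3 : (3 : F) ≠ 0)
    (C C' : SmoothPlaneQuartic F) :
    Module.finrank F C.holomorphicDifferentials = 3 ∧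
    Module.finrank F C'.holomorphicDifferentials = 3 ∧
    ∀ (i : C.holomorphicDifferentials ≃ₗ[F] C'.holomorphicDifferentials)
      (b : Module.Basis (Fin 3) F C.holomorphicDifferentials),
      ((∃ z k, C.IsCanonicalModel b z k) ∧
        ∀ z k, C.IsCanonicalModel b z k →
          Function.Injective (C.residueMap z k) ∧
          LinearMap.range (C.residueMap z k) = C.holomorphicDifferentials) ∧
      ((∃ z' k', C'.IsCanonicalModel (b.map i) z' k') ∧
        ∀ z' k', C'.IsCanonicalModel (b.map i) z' k' →
          Function.Injective (C'.residueMap z' k') ∧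
          LinearMap.range (C'.residueMap z' k') = C'.holomorphicDifferentials) := by
  exact ⟨C.finrank_holomorphicDifferentials h2 h3, C'.finrank_holomorphicDifferentials h2 h3,
    fun i b => ⟨C.canonicalModel_residueMap h2 h3 b, C'.canonicalModel_residueMap h2 h3 (b.map i)⟩⟩
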